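/- Let $R=(E,(\rho_i)_{i\in I})$ be a relational structure: a set $E$ with a family of relations $\rho_i\subseteq E^{m_i}$, $m_i\in\mathbb N$; no restriction is made on $E$ or on the index set $I$. The restriction of $R$ to $A\subseteq E$ is $R_{\restriction A}=(A,(\rho_i\cap A^{m_i})_{i\in I})$; a *local isomorphism* of $R$ (or of a linearly ordered set) is an isomorphism between two of its restrictions. A partition of $E$ into nonempty blocks $(E_x)_{x\in X}$ is a *monomorphic decomposition* of $R$ if $R_{\restriction A}$ and $R_{\restriction A'}$ are isomorphic for all finite $A,A'\subseteq E$ such that $|A\cap E_x|=|A'\cap E_x|$ for every $x\in X$; it is *finite* if $X$ is finite. There is exactly one monomorphic decomposition of $R$ of which every monomorphic decomposition of $R$ is a refinement; the number of its infinite blocks is the *monomorphic dimension* of $R$. **Theorem.** $R$ admits a finite monomorphic decomposition if and only if there exist a linear order $\le$ on $E$ and a finite partition $(E_x)_{x\in X}$ of $E$ into intervals of $(E,\le)$ such that every local isomorphism $f$ of $(E,\le)$ that preserves each interval (that is, $f(a)\in E_x$ whenever $a\in E_x$ is in the domain of $f$) is a local isomorphism of $R$. Moreover, if $R$ admits a finite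 monomorphic decomposition, then such an order and such a partition exist for which the number of infinite blocks of the partition equals the monomorphic dimension of $R$. -/

import Mathlib

open scoped FirstOrder

universe u v w

namespace Monomorphic

variable (L : FirstOrder.Language.{v, w}) {E : Type u} [L.IsRelational] [L.Structure E]

/-- The restriction of a relational structure on `E` to a subset `A` of `E`. Since the language
is relational, every subset is the carrier of a substructure. -/
def restriction (A : Set E) : L.Substructure E where
  carrier := A
  fun_mem f := isEmptyElim f

/-- Two subsets of `E` are equivalent when the structures induced on them are isomorphic. -/
def Equivalent (A A' : Set E) : Prop :=
  Nonempty (restriction L A ≃[L] restriction L A')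

/-- A bijection between two subsets of `E` is a local isomorphism of the structure on `E` if it
is an isomorphism between the restrictions of the structure to these two subsets. -/
def IsLocalIso {A A' : Set E} (f : A ≃ A') : Prop :=
  ∃ g : restriction L A ≃[L] restriction L A', ∀ x : A, ((g x : E)) = f x

/-- A set partition of `E` (into nonempty blocks) is a monomorphic decomposition if any two
finite subsets of `E` which meet each block in the same number of elements induce isomorphic
structures. -/
def IsMonomorphicDecomposition (P : Set (Set E)) : Prop :=
  Setoid.IsPartition P ∧
    ∀ A A' : Set E, A.Finite → A'.Finite →
      (∀ B ∈ P, (A ∩ B).encard = (A' ∩ B).encard) → Equivalent L A A'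

/-- `P` is a refinement of `Q`: every block of `P` is contained in a block of `Q`. -/
def Refines (P Q : Set (Set E)) : Prop :=
  ∀ B ∈ P, ∃ C ∈ Q, B ⊆ C

/-- A monomorphic decomposition of which every monomorphic decomposition is a refinement. -/
def IsMinimalDecomposition (P : Set (Set E)) : Prop :=
  IsMonomorphicDecomposition L P ∧
    ∀ Q : Set (Set E), IsMonomorphicDecomposition L Q → Refines Q P

theorem Equivalent.refl (A : Set E) : Equivalent L A A :=
  ⟨FirstOrder.Language.Equiv.refl L _⟩

variable {L} in
theorem Equivalent.symm {A B : Set E} (h : Equivalent L A B) : Equivalent L B A :=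
  h.elim fun f => ⟨f.symm⟩

variable {L} in
theorem Equivalent.trans {A B C : Set E} (h : Equivalent L A B) (h' : Equivalent L B C) :
    Equivalent L A C :=
  h.elim fun f => h'.elim fun g => ⟨g.comp f⟩

/-- Two points are related when exchanging one for the other in a finite set never changes
the isomorphism type of the induced structure. -/
def exchange : Setoid E where
  r x y := ∀ B : Set E, B.Finite → x ∉ B → y ∉ B → Equivalent L (insert x B) (insert y B)
  iseqv :=
    { refl := fun x B _ _ _ => Equivalent.refl L _
      symm := fun h B hB hx hy => (h B hB hy hx).symm
      trans := by
        intro x y z hxy hyz B hB hx hz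
        by_cases hy : y ∈ B
        · by_cases hxz : x = z
          · subst hxz
            exact Equivalent.refl L _
          have hyx : y ≠ x := fun h => hx (h ▸ hy)
          have hyz' : y ≠ z := fun h => hz (h ▸ hy)
          have hC : (B \ {y}).Finite := hB.sdiff
          have e1 := hyz (insert x (B \ {y})) (hC.insert _) (by simp [hyx])
            (by simp [Ne.symm hxz, hz])
          have e2 := hxy (insert z (B \ {y})) (hC.insert _) (by simp [hxz, hx])
            (by simp [hyz'])
          have hBy : insert y (B \ {y}) = B := by
            rw [Set.insert_sdiff_singleton, Set.insert_eq_of_mem hy]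
          rw [Set.insert_comm y x, hBy, Set.insert_comm z x] at e1
          rw [Set.insert_comm y z, hBy] at e2
          exact e1.trans e2
        · exact (hxy B hB hx hy).trans (hyz B hB hy hz) }

theorem exchange_classes_isMonomorphicDecomposition :
    IsMonomorphicDecomposition L (exchange L (E := E)).classes := by
  refine ⟨Setoid.isPartition_classes _, ?_⟩
  have key : ∀ n : ℕ, ∀ A A' : Set E, A.Finite → A'.Finite → (A \ A').ncard = n →
      (∀ B ∈ (exchange L (E := E)).classes, (A ∩ B).encard = (A' ∩ B).encard) →
      Equivalent L A A' := by
    intro n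
    induction n with
    | zero =>
      intro A A' hA hA' hn h
      have hsub : A ⊆ A' := by
        rw [Set.ncard_eq_zero hA.sdiff] at hn
        exact Set.sdiff_eq_empty.1 hn
      have : A = A' := by
        refine hsub.antisymm fun x hx => ?_
        have hB := (exchange L (E := E)).mem_classes x
        have := (hA.subset (Set.inter_subset_left (t := {y | exchange L y x}))).eq_of_subset_of_encard_le
          (Set.inter_subset_inter_left {y | exchange L y x} hsub) (h _ hB).ge
        have hx' : x ∈ A' ∩ {y | exchange L y x} := ⟨hx, (exchange L).refl x⟩
        rw [← this] at hx'
        exact hx'.1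
      rw [this]
      exact Equivalent.refl L _
    | succ n ih =>
      intro A A' hA hA' hn h
      obtain ⟨a, haA, haA'⟩ : (A \ A').Nonempty := by
        rw [← Set.ncard_pos hA.sdiff]
        omega
      have hB := (exchange L (E := E)).mem_classes a
      obtain ⟨a', ⟨ha'A', ha'a⟩, ha'A⟩ :
          ∃ a', a' ∈ A' ∩ {y | exchange L y a} ∧ a' ∉ A := by
        by_contra! hcon
        have hs : A' ∩ {y | exchange L y a} ⊆ A ∩ {y | exchange L y a} :=
          fun y hy => ⟨hcon y hy, hy.2⟩
        have := (hA'.subset (Set.inter_subset_left (t := {y | exchange L y a}))).eq_of_subset_of_encard_le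
          hs (h _ hB).le
        have ha : a ∈ A ∩ {y | exchange L y a} := ⟨haA, (exchange L).refl a⟩
        rw [← this] at ha
        exact haA' ha.1
      have hne : a ≠ a' := fun e => haA' (e ▸ ha'A')
      have hfin : (A' \ {a'}).Finite := hA'.sdiff
      have e1 : Equivalent L (insert a (A' \ {a'})) A' := by
        have := ha'a (A' \ {a'}) hfin (by simp) (by simp [haA'])
        rw [Set.insert_sdiff_singleton, Set.insert_eq_of_mem ha'A'] at this
        exact this.symm
      refine (ih A (insert a (A' \ {a'})) hA (hfin.insert _) ?_ ?_).trans e1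
      · have : A \ insert a (A' \ {a'}) = (A \ A') \ {a} := by
          ext y
          simp only [Set.mem_sdiff, Set.mem_insert_iff, Set.mem_singleton_iff]
          constructor
          · rintro ⟨h1, h2⟩
            push Not at h2
            refine ⟨⟨h1, fun h3 => ?_⟩, h2.1⟩
            exact ha'A ((h2.2 h3) ▸ h1)
          · rintro ⟨⟨h1, h2⟩, h3⟩
            exact ⟨h1, fun h4 => h4.elim h3 fun h5 => h2 h5.1⟩
        rw [this, Set.ncard_sdiff_singleton_of_mem (show a ∈ A \ A' from ⟨haA, haA'⟩), hn]
        rfl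
      · intro C hC
        rw [h C hC]
        have hiff : a ∈ C ↔ a' ∈ C := by
          obtain ⟨c, rfl⟩ := hC
          exact ⟨fun h => (exchange L).trans ha'a h,
            fun h => (exchange L).trans ((exchange L).symm ha'a) h⟩
        by_cases haC : a ∈ C
        · have ha'C := hiff.1 haC
          have e : insert a (A' \ {a'}) ∩ C = insert a ((A' ∩ C) \ {a'}) := by
            ext y
            simp only [Set.mem_inter_iff, Set.mem_sdiff, Set.mem_insert_iff,
              Set.mem_singleton_iff]
            constructor
            · rintro ⟨h1 | h1, h2⟩
              · exact Or.inl h1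
              · exact Or.inr ⟨⟨h1.1, h2⟩, h1.2⟩
            · rintro (h1 | h1)
              · exact ⟨Or.inl h1, h1 ▸ haC⟩
              · exact ⟨Or.inr ⟨h1.1.1, h1.2⟩, h1.1.2⟩
          rw [e, Set.encard_insert_of_notMem (by simp [haA']),
            Set.encard_sdiff_singleton_add_one (show a' ∈ A' ∩ C from ⟨ha'A', ha'C⟩)]
        · have ha'C : a' ∉ C := fun h => haC (hiff.2 h)
          congr 1
          ext y
          simp only [Set.mem_inter_iff, Set.mem_sdiff, Set.mem_insert_iff,
            Set.mem_singleton_iff]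
          constructor
          · rintro ⟨h1, h2⟩
            exact ⟨Or.inr ⟨h1, fun h3 => ha'C (h3 ▸ h2)⟩, h2⟩
          · rintro ⟨h1 | h1, h2⟩
            · exact absurd (h1 ▸ h2) haC
            · exact ⟨h1.1, h2⟩
  exact fun A A' hA hA' h => key _ A A' hA hA' rfl h

theorem exchange_classes_isMinimalDecomposition :
    IsMinimalDecomposition L (exchange L (E := E)).classes := by
  refine ⟨exchange_classes_isMonomorphicDecomposition L, ?_⟩
  rintro Q ⟨hQ, hQ'⟩ B hB
  obtain ⟨b, hb⟩ := Setoid.nonempty_of_mem_partition hQ hB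
  refine ⟨_, (exchange L (E := E)).mem_classes b, fun y hy => ?_⟩
  intro D hD hyD hbD
  refine hQ' _ _ (hD.insert _) (hD.insert _) fun C hC => ?_
  by_cases hCB : C = B
  · subst hCB
    rw [Set.insert_inter_of_mem hy, Set.insert_inter_of_mem hb,
      Set.encard_insert_of_notMem (fun h => hyD h.1),
      Set.encard_insert_of_notMem (fun h => hbD h.1)]
  · have hdis : Disjoint C B := hQ.pairwiseDisjoint hC hB hCB
    rw [Set.insert_inter_of_notMem (fun h => Set.disjoint_left.1 hdis h hy),
      Set.insert_inter_of_notMem (fun h => Set.disjoint_left.1 hdis h hb)]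

/-- Every relational structure has exactly one minimal monomorphic decomposition. -/
theorem existsUnique_isMinimalDecomposition :
    ∃! P : Set (Set E), IsMinimalDecomposition L P := by
  have anti : ∀ P Q : Set (Set E), IsMinimalDecomposition L P →
      IsMinimalDecomposition L Q → P ⊆ Q := by
    intro P Q hP hQ B hB
    obtain ⟨C, hC, hBC⟩ := hQ.2 P hP.1 B hB
    obtain ⟨D, hD, hCD⟩ := hP.2 Q hQ.1 C hC
    obtain ⟨b, hb⟩ := Setoid.nonempty_of_mem_partition hP.1.1 hB
    have hBD : B = D := by
      by_contra hne
      exact Set.disjoint_left.1 (hP.1.1.pairwiseDisjoint hB hD hne) hb (hCD (hBC hb))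
    have : B = C := hBC.antisymm (hBD ▸ hCD)
    exact this ▸ hC
  have h0 := exchange_classes_isMinimalDecomposition L (E := E)
  exact ⟨_, h0, fun P hP => (anti _ _ hP h0).antisymm (anti _ _ h0 hP)⟩

variable (E) in
/-- The minimal monomorphic decomposition of the structure on `E`. -/
noncomputable def minimalDecomposition : Set (Set E) :=
  (existsUnique_isMinimalDecomposition L (E := E)).choose

/-- The number of infinite blocks of a partition. -/
noncomputable def numInfiniteBlocks {E : Type u} (P : Set (Set E)) : ℕ∞ :=
  {B ∈ P | B.Infinite}.encard

variable (E) in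
/-- The monomorphic dimension: the number of infinite blocks of the minimal monomorphic
decomposition. -/
noncomputable def monomorphicDimension : ℕ∞ :=
  numInfiniteBlocks (minimalDecomposition L E)

variable (E) in
/-- The structure on `E` admits a monomorphic decomposition with finitely many blocks. -/
def HasFiniteMonomorphicDecomposition : Prop :=
  ∃ P : Set (Set E), P.Finite ∧ IsMonomorphicDecomposition L P

/-- `P` is a finite partition of the chain `E` into intervals such that every local isomorphism
of the chain which preserves each interval is a local isomorphism of the structure on `E`. -/
def IsChainablePartition [LinearOrder E] (P : Set (Set E)) : Prop :=
  Setoid.IsPartition P ∧ P.Finite ∧ (∀ B ∈ P, B.OrdConnected) ∧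
    ∀ (A A' : Set E) (f : A ≃o A'),
      (∀ B ∈ P, ∀ x : A, (x : E) ∈ B → (f x : E) ∈ B) → IsLocalIso L f.toEquiv

end Monomorphic

/-! If the blocks are intervals of a chain, the increasing bijections between corresponding finite
pieces paste together to a local isomorphism of the chain, so one direction is immediate. The
substance is the converse. The coarsest decomposition consists of the classes of `exchange`. A
finite class need not be compatible with any order, so it is cut into singletons, whose points every
admissible local isomorphism fixes (`splitFinite`). The infinite blocks are untouched, which gives
the statement on the dimension.

Colour each point by its block. An order is needed for which every relation depends only on the
colours and the order of the entries. Given finitely many points and relations, enlarge the set of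
points to a finite set `A`. A Ramsey argument with iterated ultrafilter quantifiers yields a finite
list with the same number of entries of each colour as `A`, along which these relations depend only
on colours and order (`exists_indiscernible_list`). Monomorphy gives an isomorphism from `A` onto
this list, and the order of the list is pulled back to `A` (`exists_rank`).

The pullback is useful only if the isomorphism is compatible with the colours. So `A` is taken rich
enough for `exchange` to be recognisable inside it, with each infinite class meeting `A` in a number
of points shared by no other class. The isomorphism then preserves every infinite class
(`exists_bound_isoOn_preserves_classes`); it may permute points of finite classes, which is harmless
because their colours are carried by single points. An ultraproduct of the finite rankings orders
all of `E` (`exists_linearOrder_relMap_iff`). -/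

namespace Monomorphic

/-! ### Isomorphisms of restrictions as maps on `E` -/

section Isomorphisms

variable (L : FirstOrder.Language.{v, w}) {E : Type u} [L.Structure E]

/-- `f` induces an isomorphism from the restriction to `A` onto the restriction to `A'`. -/
def IsoOn (f : E → E) (A A' : Set E) : Prop :=
  Set.BijOn f A A' ∧ ∀ (n : ℕ) (r : L.Relations n) (x : Fin n → E), (∀ i, x i ∈ A) →
    (FirstOrder.Language.Structure.RelMap r (f ∘ x) ↔ FirstOrder.Language.Structure.RelMap r x)

variable {L} in
theorem IsoOn.mono {f : E → E} {A A' D : Set E} (h : IsoOn L f A A') (hD : D ⊆ A) :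
    IsoOn L f D (f '' D) :=
  ⟨(h.1.injOn.mono hD).bijOn_image, fun n r x hx => h.2 n r x fun i => hD (hx i)⟩

variable [L.IsRelational]

theorem equivalent_iff_exists_isoOn {A A' : Set E} :
    Equivalent L A A' ↔ ∃ f : E → E, IsoOn L f A A' := by
  classical
  constructor
  · rintro ⟨g⟩
    refine ⟨fun a => if h : a ∈ A then (g ⟨a, h⟩ : E) else a, ⟨?_, ?_, ?_⟩, ?_⟩
    · intro a ha
      simp only [dif_pos ha]
      exact (g ⟨a, ha⟩).2
    · intro a ha b hb hab
      simp only [dif_pos ha, dif_pos hb] at hab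
      exact congrArg Subtype.val (g.injective (Subtype.ext hab))
    · intro b hb
      obtain ⟨a, ha⟩ := g.surjective ⟨b, hb⟩
      refine ⟨a, a.2, ?_⟩
      have ha' : (a : E) ∈ A := a.2
      simp only [dif_pos ha']
      exact congrArg Subtype.val ha
    · intro n r x hx
      have h := g.map_rel r (fun i => (⟨x i, hx i⟩ : restriction L A))
      have e : (fun a => if h : a ∈ A then (g ⟨a, h⟩ : E) else a) ∘ x =
          fun i => (g ⟨x i, hx i⟩ : E) := by
        funext i
        simp only [Function.comp_apply, dif_pos (hx i)]
      rw [e]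
      exact h
  · rintro ⟨f, hf, hr⟩
    exact ⟨{ toEquiv := hf.equiv f
             map_fun' := fun φ => isEmptyElim φ
             map_rel' := fun r x => hr _ r (fun i => (x i : E)) fun i => (x i).2 }⟩

theorem isLocalIso_of_relMap_iff {A A' : Set E} (f : A ≃ A')
    (h : ∀ (n : ℕ) (r : L.Relations n) (x : Fin n → A),
      FirstOrder.Language.Structure.RelMap r (fun i => (f (x i) : E)) ↔
        FirstOrder.Language.Structure.RelMap r (fun i => (x i : E))) :
    IsLocalIso L f :=
  ⟨{ toEquiv := f
     map_fun' := fun φ => isEmptyElim φ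
     map_rel' := fun r x => h _ r x }, fun _ => rfl⟩

end Isomorphisms

/-! ### Partitions into intervals are monomorphic decompositions -/

section Intervals

variable {E : Type u}

theorem exists_strictMonoOn_bijOn [LinearOrder E] {S T : Set E} (hS : S.Finite) (hT : T.Finite)
    (h : S.encard = T.encard) : ∃ f : E → E, Set.BijOn f S T ∧ StrictMonoOn f S := by
  classical
  have := hS.fintype
  have := hT.fintype
  have hc : Fintype.card S = Fintype.card T := by
    have h' : S.ncard = T.ncard := congrArg ENat.toNat h
    rwa [← Nat.card_coe_set_eq, ← Nat.card_coe_set_eq, Nat.card_eq_fintype_card,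
      Nat.card_eq_fintype_card] at h'
  let g : S ≃o T := (Fintype.orderIsoFinOfCardEq S rfl).symm.trans
    (Fintype.orderIsoFinOfCardEq T hc.symm)
  refine ⟨fun a => if h : a ∈ S then (g ⟨a, h⟩ : E) else a, ⟨?_, ?_, ?_⟩, ?_⟩
  · intro a ha
    simp only [dif_pos ha]
    exact (g ⟨a, ha⟩).2
  · intro a ha b hb hab
    simp only [dif_pos ha, dif_pos hb] at hab
    exact congrArg Subtype.val (g.injective (Subtype.ext hab))
  · intro b hb
    obtain ⟨a, ha⟩ := g.surjective ⟨b, hb⟩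
    refine ⟨a, a.2, ?_⟩
    simp only [dif_pos a.2]
    exact congrArg Subtype.val ha
  · intro a ha b hb hab
    simp only [dif_pos ha, dif_pos hb]
    exact g.strictMono hab

theorem lt_of_mem_disjoint_ordConnected [LinearOrder E] {B C : Set E} (hB : B.OrdConnected)
    (hC : C.OrdConnected) (hBC : Disjoint B C) {x x' y y' : E} (hx : x ∈ B) (hx' : x' ∈ B)
    (hy : y ∈ C) (hy' : y' ∈ C) (hxy : x < y) : x' < y' := by
  by_contra! hcon
  rcases le_or_gt y x' with h | h
  · exact Set.disjoint_left.1 hBC (hB.out hx hx' ⟨hxy.le, h⟩) hy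
  · exact Set.disjoint_left.1 hBC hx' (hC.out hy' hy ⟨hcon, h.le⟩)

/-- Finite traces of equal size on a block are matched by an increasing bijection. Disjoint
intervals compare the same way at all their points, so the union of these bijections over the blocks
is again increasing. -/
theorem IsChainablePartition.isMonomorphicDecomposition {L : FirstOrder.Language.{v, w}}
    [L.IsRelational] [L.Structure E] [LinearOrder E] {P : Set (Set E)}
    (h : IsChainablePartition L P) : IsMonomorphicDecomposition L P := by
  obtain ⟨hP, -, hI, hL⟩ := h
  refine ⟨hP, fun A A' hA hA' hAA' => ?_⟩
  have hex : ∀ B : Set E, ∃ g : E → E,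
      B ∈ P → Set.BijOn g (A ∩ B) (A' ∩ B) ∧ StrictMonoOn g (A ∩ B) := fun B => by
    by_cases hB : B ∈ P
    · obtain ⟨g, hg⟩ := exists_strictMonoOn_bijOn (hA.subset Set.inter_subset_left)
        (hA'.subset Set.inter_subset_left) (hAA' B hB)
      exact ⟨g, fun _ => hg⟩
    · exact ⟨id, fun h => absurd h hB⟩
  choose g hg' using hex
  have hg := fun B hB => (hg' B hB).1
  have hgm := fun B hB => (hg' B hB).2
  choose blk hblk hblk' using fun x => (hP.2 x).exists
  have hmem : ∀ x ∈ A, g (blk x) x ∈ A' ∩ blk x := fun x hx =>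
    (hg _ (hblk x)).mapsTo ⟨hx, hblk' x⟩
  have huniq : ∀ x, ∀ B ∈ P, x ∈ B → blk x = B := fun x B hB hx =>
    (hP.2 x).unique ⟨hblk x, hblk' x⟩ ⟨hB, hx⟩
  let f : A → A' := fun x => ⟨g (blk x) x, (hmem x x.2).1⟩
  have hf : StrictMono f := by
    intro x y hxy
    change g (blk x) x < g (blk y) y
    by_cases hxy' : blk x = blk y
    · rw [← hxy']
      exact hgm _ (hblk x) ⟨x.2, hblk' x⟩ ⟨y.2, hxy' ▸ hblk' y⟩ hxy
    · exact lt_of_mem_disjoint_ordConnected (hI _ (hblk x)) (hI _ (hblk y))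
        (hP.pairwiseDisjoint (hblk x) (hblk y) hxy') (hblk' x) (hmem x x.2).2 (hblk' y)
        (hmem y y.2).2 hxy
  have hs : Function.Surjective f := by
    intro y
    obtain ⟨x, hx, hxy⟩ := (hg _ (hblk y)).surjOn ⟨y.2, hblk' y⟩
    refine ⟨⟨x, hx.1⟩, Subtype.ext ?_⟩
    change g (blk x) x = y
    rw [huniq x _ (hblk y) hx.2, hxy]
  obtain ⟨e, -⟩ := hL A A' (hf.orderIsoOfSurjective f hs) fun B hB x hx => by
    have := (hmem x x.2).2
    rw [huniq x B hB hx] at this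
    change g (blk x) x ∈ B
    rwa [huniq x B hB hx]
  exact ⟨e⟩

end Intervals

/-! ### Indiscernible lists from iterated ultrafilter quantifiers -/

section Ramsey

variable {E : Type u} {K : Type*}

/-- The iterated quantifier `∀ᶠ a₁ in U k₁, …, ∀ᶠ aₙ in U kₙ, φ [a₁, …, aₙ]`. -/
def IterEventually (U : K → Ultrafilter E) : List K → (List E → Prop) → Prop
  | [], φ => φ []
  | k :: w, φ => ∀ᶠ a in (U k : Filter E), IterEventually U w fun l => φ (a :: l)

/-- Induction on the word of colours. The first entry is chosen generic, so that fixing it does not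
change the limit truth value of any predicate on any subword of the rest. The predicates with this
entry fixed then join the set to be treated, which is why `Φ` varies in the induction. -/
theorem exists_homogeneous_list {U : K → Ultrafilter E} {c : E → K}
    (hU : ∀ k, ∀ᶠ a in (U k : Filter E), c a = k) (w : List K) :
    ∀ Φ : Set (List E → Prop), Φ.Finite → ∃ l : List E, l.map c = w ∧
      ∀ l', l'.Sublist l → ∀ φ ∈ Φ, (φ l' ↔ IterEventually U (l'.map c) φ) := by
  induction w with
  | nil =>
    intro Φ _
    refine ⟨[], rfl, fun l' hl' φ _ => ?_⟩
    rw [List.sublist_nil.1 hl']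
    exact Iff.rfl
  | cons k w ih =>
    intro Φ hΦ
    have hfin : {v : List K | v.Sublist w}.Finite := by
      refine (List.finite_toSet w.sublists).subset fun v hv => ?_
      exact List.mem_sublists.2 hv
    have key : ∀ᶠ a in (U k : Filter E), ∀ φ ∈ Φ, ∀ v ∈ {v : List K | v.Sublist w},
        (IterEventually U v (fun l => φ (a :: l)) ↔ IterEventually U (k :: v) φ) := by
      rw [Filter.eventually_all_finite hΦ]
      intro φ _
      rw [Filter.eventually_all_finite hfin]
      intro v _
      -- An ultrafilter decides the predicate, so almost every `a` agrees with the limit value.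
      by_cases h : IterEventually U (k :: v) φ
      · filter_upwards [h] with a ha
        exact iff_of_true ha h
      · filter_upwards [Ultrafilter.eventually_not.2 h] with a ha
        exact iff_of_false ha h
    obtain ⟨a, ha, hak⟩ := (key.and (hU k)).exists
    obtain ⟨l, hlw, hl⟩ := ih (Φ ∪ (fun φ l => φ (a :: l)) '' Φ) (hΦ.union (hΦ.image _))
    refine ⟨a :: l, by rw [List.map_cons, hak, hlw], fun l' hl' φ hφ => ?_⟩
    rcases List.sublist_cons_iff.1 hl' with h | ⟨m, rfl, hm⟩
    · exact hl l' h φ (Or.inl hφ)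
    · have h1 := hl m hm _ (Or.inr ⟨φ, hφ, rfl⟩)
      have h2 := ha φ hφ (m.map c) (by
        rw [← hlw]
        exact hm.map c)
      rw [List.map_cons, hak]
      exact h1.trans h2

/-- Two families of indices in the same order are the images of one family under two
increasing maps. -/
theorem exists_orderEmbedding_comp {n N : ℕ} (s t : Fin n → Fin N)
    (h : ∀ i j, s i < s j ↔ t i < t j) :
    ∃ p ≤ n, ∃ (σ : Fin n → Fin p) (σ' : Fin p → Fin n) (a b : Fin p ↪o Fin N),
      s = a ∘ σ ∧ t = b ∘ σ ∧ ⇑a = s ∘ σ' ∧ ⇑b = t ∘ σ' := by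
  classical
  let S := Finset.univ.image s
  have hr := Finset.range_orderEmbOfFin S rfl
  have h1 : ∀ i, ∃ q, S.orderEmbOfFin rfl q = s i := fun i => by
    have : s i ∈ Set.range (S.orderEmbOfFin rfl) := by
      rw [hr]
      simp [S]
    exact this
  have h2 : ∀ q, ∃ i, s i = S.orderEmbOfFin rfl q := fun q => by
    obtain ⟨i, -, hi⟩ := Finset.mem_image.1 (Finset.orderEmbOfFin_mem S rfl q)
    exact ⟨i, hi⟩
  choose σ hσ using h1
  choose σ' hσ' using h2
  -- Equality is incomparability in both directions, so the order hypothesis transports it as well.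
  have heq : ∀ i j, s i = s j → t i = t j := fun i j hij =>
    le_antisymm (not_lt.1 fun hh => ((h j i).2 hh).ne hij.symm)
      (not_lt.1 fun hh => ((h i j).2 hh).ne hij)
  refine ⟨S.card, ?_, σ, σ', S.orderEmbOfFin rfl,
    OrderEmbedding.ofStrictMono (t ∘ σ') ?_, ?_, ?_, ?_, rfl⟩
  · simpa using Finset.card_image_le (s := Finset.univ) (f := s)
  · intro q q' hq
    apply (h _ _).1
    rw [hσ', hσ']
    exact (S.orderEmbOfFin rfl).strictMono hq
  · funext i
    exact (hσ i).symm
  · funext i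
    exact heq _ _ (by rw [hσ', hσ])
  · funext q
    exact (hσ' q).symm

/-- The property of a list that its entries, arranged along `σ`, satisfy `ψ`. -/
def ListPattern {n p : ℕ} (ψ : (Fin n → E) → Prop) (σ : Fin n → Fin p) (l : List E) : Prop :=
  ∃ z : Fin p → E, l = List.ofFn z ∧ ψ (z ∘ σ)

theorem listPattern_ofFn {n p : ℕ} {ψ : (Fin n → E) → Prop} {σ : Fin n → Fin p}
    {z : Fin p → E} : ListPattern ψ σ (List.ofFn z) ↔ ψ (z ∘ σ) := by
  refine ⟨?_, fun h => ⟨z, rfl, h⟩⟩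
  rintro ⟨z', hz, h⟩
  rwa [List.ofFn_injective hz]

theorem ofFn_get_comp_sublist {l : List E} {p : ℕ} (a : Fin p ↪o Fin l.length) :
    (List.ofFn (l.get ∘ a)).Sublist l := by
  rw [List.sublist_iff_exists_fin_orderEmbedding_get_eq]
  refine ⟨(Fin.castOrderIso (by simp)).toOrderEmbedding.trans a, fun ix => ?_⟩
  simp
  rfl

/-- A finite list of distinct elements with prescribed colours, along which the truth of
finitely many predicates on tuples depends only on the colours and the order of the entries. -/
theorem exists_indiscernible_list {c : E → K} {U : K → Ultrafilter E}
    (hU : ∀ k, ∀ᶠ a in (U k : Filter E), c a = k) (w : List K)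
    (hw : ∀ k, [k, k].Sublist w → ∀ b, ∀ᶠ a in (U k : Filter E), a ≠ b)
    (Ψ : Set (Σ n : ℕ, (Fin n → E) → Prop)) (hΨ : Ψ.Finite) :
    ∃ l : List E, l.map c = w ∧ l.Nodup ∧ ∀ ψ ∈ Ψ, ∀ s t : Fin ψ.1 → Fin l.length,
      (∀ i, c (l.get (s i)) = c (l.get (t i))) → (∀ i j, s i < s j ↔ t i < t j) →
      (ψ.2 (l.get ∘ s) ↔ ψ.2 (l.get ∘ t)) := by
  -- Tuples may repeat or permute entries, whereas sublists are increasing; each pattern `σ` of a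
  -- tuple turns a predicate into one on sublists. `List.Nodup` is included to separate the entries.
  let Φ : Set (List E → Prop) := {List.Nodup} ∪
    ⋃ ψ ∈ Ψ, Set.range fun τ : (Σ p : Fin (ψ.1 + 1), Fin ψ.1 → Fin p) => ListPattern ψ.2 τ.2
  have hΦ : Φ.Finite :=
    (Set.finite_singleton _).union (hΨ.biUnion fun ψ _ => Set.finite_range _)
  obtain ⟨l, hlw, hl⟩ := exists_homogeneous_list hU w Φ hΦ
  refine ⟨l, hlw, ?_, ?_⟩
  · rw [List.nodup_iff_sublist]
    -- A repeated entry repeats its colour in `w`; by `hw` a generic pair of that colour is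
    -- distinct, which contradicts homogeneity.
    intro a ha
    have hk : [c a, c a].Sublist w := by
      rw [← hlw]
      exact ha.map c
    have h := (hl [a, a] ha List.Nodup (Or.inl rfl)).2 (by
      refine Filter.Eventually.of_forall fun b => ?_
      filter_upwards [hw _ hk b] with b' hb'
      change [b, b'].Nodup
      simp [hb'.symm])
    simp at h
  · intro ψ hψ s t hc hst
    obtain ⟨p, hp, σ, σ', a, b, rfl, rfl, ha, hb⟩ := exists_orderEmbedding_comp s t hst
    have hmem : ListPattern ψ.2 σ ∈ Φ :=
      Or.inr (Set.mem_biUnion hψ ⟨⟨⟨p, Nat.lt_succ_of_le hp⟩, σ⟩, rfl⟩)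
    have e : (List.ofFn (l.get ∘ a)).map c = (List.ofFn (l.get ∘ b)).map c := by
      rw [List.map_ofFn, List.map_ofFn]
      congr 1
      funext q
      have hq := hc (σ' q)
      have h1 : a (σ (σ' q)) = a q := (congrFun ha q).symm
      have h2 : b (σ (σ' q)) = b q := (congrFun hb q).symm
      simp only [Function.comp_apply, h1, h2] at hq
      exact hq
    have h1 := hl _ (ofFn_get_comp_sublist a) _ hmem
    have h2 := hl _ (ofFn_get_comp_sublist b) _ hmem
    rw [e, ← h2, listPattern_ofFn, listPattern_ofFn] at h1
    exact h1

end Ramsey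

/-! ### Rich finite sets -/

section RichSets

variable {E : Type u}

/-- The class of `x`. -/
def cls (s : Setoid E) (x : E) : Set E := {y | s y x}

theorem mem_cls_self (s : Setoid E) (x : E) : x ∈ cls s x := s.refl x

theorem cls_eq {s : Setoid E} {x y : E} (h : s x y) : cls s x = cls s y :=
  Set.ext fun _ => ⟨fun hz => s.trans hz h, fun hz => s.trans hz (s.symm h)⟩

theorem rel_of_mem_cls {s : Setoid E} {x y z : E} (hx : z ∈ cls s x) (hy : z ∈ cls s y) :
    s x y := s.trans (s.symm hx) hy

/-- `A` is finite, contains the finite classes and has more than `M` elements in each infinite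
class. -/
structure IsRich (s : Setoid E) (M : ℕ) (A : Set E) : Prop where
  finite : A.Finite
  subset : ∀ x, (cls s x).Finite → cls s x ⊆ A
  lt_ncard : ∀ x, (cls s x).Infinite → M < (A ∩ cls s x).ncard

theorem exists_subset_encard_inter_cls (s : Setoid E) {D T : Set E}
    (h : ∀ x, (D ∩ cls s x).encard ≤ (T ∩ cls s x).encard) :
    ∃ D' ⊆ T, ∀ x, (D' ∩ cls s x).encard = (D ∩ cls s x).encard := by
  choose f hf hf' using fun q : Quotient s => Set.exists_subset_encard_eq (h q.out)
  refine ⟨⋃ q, f q, Set.iUnion_subset fun q => (hf q).trans Set.inter_subset_left, fun x => ?_⟩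
  have hx : s (Quotient.mk s x).out x := Quotient.mk_out x
  have e : (⋃ q, f q) ∩ cls s x = f (Quotient.mk s x) := by
    ext y
    constructor
    · rintro ⟨hy, hyx⟩
      obtain ⟨q, hq⟩ := Set.mem_iUnion.1 hy
      have : s q.out x := rel_of_mem_cls (hf q hq).2 hyx
      have e : q = Quotient.mk s x := by
        rw [← q.out_eq]
        exact Quotient.sound this
      exact e ▸ hq
    · intro hy
      exact ⟨Set.mem_iUnion.2 ⟨_, hy⟩, cls_eq hx ▸ (hf _ hy).2⟩
  rw [e, hf', cls_eq hx]

/-- There are finite supersets of any finite set that are rich and meet distinct classes, one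
of them infinite, in different numbers of elements. -/
theorem exists_isRich_superset (s : Setoid E) [Finite (Quotient s)] (M : ℕ) {A : Set E}
    (hA : A.Finite) : ∃ B, A ⊆ B ∧ IsRich s M B ∧ ∀ x y, (cls s x).Infinite →
      (B ∩ cls s x).ncard = (B ∩ cls s y).ncard → s x y := by
  classical
  have := Fintype.ofFinite (Quotient s)
  -- `ncard` is `0` on infinite classes, so `C` bounds the size of every finite class. The sizes `n
  -- q` exceed `M` and `C`, leave room for `A`, and are pairwise distinct.
  let C : ℕ := ∑ q : Quotient s, (cls s q.out).ncard
  let n : Quotient s → ℕ := fun q => M + A.ncard + C + 1 + (Fintype.equivFin (Quotient s) q)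
  have hex : ∀ q : Quotient s, ∃ T : Set E, T ⊆ cls s q.out ∧ A ∩ cls s q.out ⊆ T ∧ T.Finite ∧
      ((cls s q.out).Infinite → T.ncard = n q) ∧ ((cls s q.out).Finite → T = cls s q.out) := by
    intro q
    by_cases hq : (cls s q.out).Finite
    · exact ⟨_, subset_rfl, Set.inter_subset_right, hq, fun h => absurd hq h, fun _ => rfl⟩
    · have hq' : (cls s q.out).Infinite := hq
      have hle : (A ∩ cls s q.out).ncard ≤ n q := by
        have := Set.ncard_le_ncard (Set.inter_subset_left (s := A) (t := cls s q.out)) hA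
        simp only [n]
        omega
      obtain ⟨T, h1, h2, h3⟩ := hq'.exists_superset_ncard_eq Set.inter_subset_right
        (hA.subset Set.inter_subset_left) hle
      refine ⟨T, h2, h1, Set.finite_of_ncard_pos ?_, fun _ => h3, fun h => absurd h hq⟩
      rw [h3]
      simp only [n]
      omega
  choose T hT hAT hTf hTi hTe using hex
  have hout : ∀ x, cls s (Quotient.mk s x).out = cls s x := fun x => cls_eq (Quotient.mk_out x)
  have hB : ∀ x, (⋃ q, T q) ∩ cls s x = T (Quotient.mk s x) := by
    intro x
    ext y
    constructor
    · rintro ⟨hy, hyx⟩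
      obtain ⟨q, hq⟩ := Set.mem_iUnion.1 hy
      have : s q.out x := rel_of_mem_cls (hT q hq) hyx
      have e : q = Quotient.mk s x := by
        rw [← q.out_eq]
        exact Quotient.sound this
      exact e ▸ hq
    · intro hy
      exact ⟨Set.mem_iUnion.2 ⟨_, hy⟩, hout x ▸ hT _ hy⟩
  refine ⟨⋃ q, T q, ?_, ⟨Set.finite_iUnion hTf, ?_, ?_⟩, ?_⟩
  · intro x hx
    refine Set.mem_iUnion.2 ⟨Quotient.mk s x, hAT _ ⟨hx, ?_⟩⟩
    rw [hout]
    exact mem_cls_self s x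
  · intro x hx y hy
    refine Set.mem_iUnion.2 ⟨Quotient.mk s x, ?_⟩
    rw [hTe _ (by rwa [hout]), hout]
    exact hy
  · intro x hx
    rw [hB, hTi _ (by rwa [hout])]
    simp only [n]
    omega
  · intro x y hx hxy
    rw [hB, hB, hTi _ (by rwa [hout])] at hxy
    by_cases hy : (cls s y).Finite
    · rw [hTe (Quotient.mk s y) (by rwa [hout])] at hxy
      have : (cls s (Quotient.mk s y).out).ncard ≤ C :=
        Finset.single_le_sum (f := fun q : Quotient s => (cls s q.out).ncard)
          (fun _ _ => Nat.zero_le _) (Finset.mem_univ _)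
      simp only [n] at hxy
      omega
    · rw [hTi (Quotient.mk s y) (by rwa [hout])] at hxy
      have h : Fintype.equivFin (Quotient s) (Quotient.mk s x) =
          Fintype.equivFin (Quotient s) (Quotient.mk s y) := by
        apply Fin.ext
        simp only [n] at hxy
        omega
      exact Quotient.exact ((Fintype.equivFin (Quotient s)).injective h)

end RichSets

/-! ### Recognising the exchange relation inside a rich set -/

section Exchange

variable (L : FirstOrder.Language.{v, w}) {E : Type u} [L.IsRelational] [L.Structure E]

theorem equivalent_insert_of_encard_eq {D D' : Set E} {x x' : E} (hD : D.Finite)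
    (hD' : D'.Finite) (hx : x ∉ D) (hx' : x' ∉ D') (hxx' : exchange L x x')
    (h : ∀ z, (D' ∩ cls (exchange L) z).encard = (D ∩ cls (exchange L) z).encard) :
    Equivalent L (insert x D) (insert x' D') := by
  refine (exchange_classes_isMonomorphicDecomposition L).2 _ _ (hD.insert _) (hD'.insert _) ?_
  rintro _ ⟨z, rfl⟩
  change (insert x D ∩ cls (exchange L) z).encard = (insert x' D' ∩ cls (exchange L) z).encard
  by_cases hz : x ∈ cls (exchange L) z
  · have hz' : x' ∈ cls (exchange L) z := (exchange L).trans ((exchange L).symm hxx') hz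
    rw [Set.insert_inter_of_mem hz, Set.insert_inter_of_mem hz',
      Set.encard_insert_of_notMem fun h => hx h.1,
      Set.encard_insert_of_notMem fun h => hx' h.1, h]
  · have hz' : x' ∉ cls (exchange L) z := fun h => hz ((exchange L).trans hxx' h)
    rw [Set.insert_inter_of_notMem hz, Set.insert_inter_of_notMem hz', h]

/-- Since `x` and `y` are inequivalent, deleting both costs each class at most one point. An
infinite class can spare it, having more than `M` points in `A`. A finite class lies in `A`, and if
it loses a point, then `D` misses `x₀` or `y₀` there. -/
theorem encard_inter_cls_le {s : Setoid E} {M : ℕ} {A D : Set E} (hA : IsRich s M A)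
    (hD : D.Finite) (hDM : D.ncard ≤ M) {x y x₀ y₀ : E} (hxy : ¬ s x y)
    (hx : s x₀ x) (hy : s y₀ y) (hx₀ : x₀ ∉ D) (hy₀ : y₀ ∉ D) (z : E) :
    (D ∩ cls s z).encard ≤ ((A \ {x, y}) ∩ cls s z).encard := by
  by_cases hz : (cls s z).Finite
  · have key : ∀ a a₀ : E, s a₀ a → a₀ ∉ D → a ∈ cls s z →
        (D ∩ cls s z).encard ≤ (cls s z \ {a}).encard := by
      intro a a₀ ha ha₀ haz
      have haz₀ : a₀ ∈ cls s z := s.trans ha haz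
      have h1 : (D ∩ cls s z).encard ≤ (cls s z \ {a₀}).encard :=
        Set.encard_le_encard fun t ht => ⟨ht.2, fun e => ha₀ (e ▸ ht.1)⟩
      have h2 := Set.encard_sdiff_singleton_add_one haz
      have h3 := Set.encard_sdiff_singleton_add_one haz₀
      rw [← h3] at h2
      exact h1.trans (WithTop.add_right_cancel ENat.one_ne_top h2).ge
    have hsub := hA.subset z hz
    by_cases hxz : x ∈ cls s z
    · refine (key x x₀ hx hx₀ hxz).trans (Set.encard_le_encard ?_)
      rintro t ⟨ht, htx⟩
      refine ⟨⟨hsub ht, ?_⟩, ht⟩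
      rintro (rfl | rfl)
      · exact htx rfl
      · exact hxy (s.trans hxz (s.symm ht))
    · by_cases hyz : y ∈ cls s z
      · refine (key y y₀ hy hy₀ hyz).trans (Set.encard_le_encard ?_)
        rintro t ⟨ht, hty⟩
        refine ⟨⟨hsub ht, ?_⟩, ht⟩
        rintro (rfl | rfl)
        · exact hxz ht
        · exact hty rfl
      · refine Set.encard_le_encard ?_
        rintro t ⟨-, ht⟩
        refine ⟨⟨hsub ht, ?_⟩, ht⟩
        rintro (rfl | rfl)
        · exact hxz ht
        · exact hyz ht
  · have h1 : (D ∩ cls s z).ncard ≤ M :=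
      (Set.ncard_le_ncard Set.inter_subset_left hD).trans hDM
    have h2 := hA.lt_ncard z hz
    have hfin : (A ∩ cls s z).Finite := hA.finite.subset Set.inter_subset_left
    have h3 : ∃ a, (A ∩ cls s z) \ {a} ⊆ (A \ {x, y}) ∩ cls s z := by
      by_cases hxz : x ∈ cls s z
      · refine ⟨x, ?_⟩
        rintro t ⟨ht, htx⟩
        refine ⟨⟨ht.1, ?_⟩, ht.2⟩
        rintro (rfl | rfl)
        · exact htx rfl
        · exact hxy (s.trans hxz (s.symm ht.2))
      · refine ⟨y, ?_⟩
        rintro t ⟨ht, hty⟩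
        refine ⟨⟨ht.1, ?_⟩, ht.2⟩
        rintro (rfl | rfl)
        · exact hxz ht.2
        · exact hty rfl
    obtain ⟨a, ha⟩ := h3
    have h4 := Set.ncard_le_ncard ha (hA.finite.sdiff.subset Set.inter_subset_left)
    have h5 := Set.ncard_le_ncard_sdiff_add_ncard (A ∩ cls s z) {a}
    rw [Set.ncard_singleton] at h5
    rw [← (hD.subset Set.inter_subset_left).cast_ncard_eq,
      ← (hA.finite.sdiff.subset Set.inter_subset_left).cast_ncard_eq]
    exact_mod_cast by omega

/-- Inequivalent points are separated inside every sufficiently rich set. -/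
theorem exists_separating_subset [Finite (Quotient (exchange L (E := E)))] :
    ∃ M : ℕ, ∀ A : Set E, IsRich (exchange L) M A → ∀ x y, ¬ exchange L x y →
      ∃ D ⊆ A, x ∉ D ∧ y ∉ D ∧ ¬ Equivalent L (insert x D) (insert y D) := by
  have hex : ∀ q : Quotient (exchange L (E := E)) × Quotient (exchange L (E := E)),
      ∃ D : Set E, D.Finite ∧ (¬ exchange L q.1.out q.2.out →
        q.1.out ∉ D ∧ q.2.out ∉ D ∧
          ¬ Equivalent L (insert q.1.out D) (insert q.2.out D)) := by
    intro q
    by_cases h : exchange L q.1.out q.2.out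
    · exact ⟨∅, Set.finite_empty, fun h' => absurd h h'⟩
    · have h' := h
      change ¬ ∀ B : Set E, _ at h'
      push Not at h'
      obtain ⟨D, h1, h2, h3, h4⟩ := h'
      exact ⟨D, h1, fun _ => ⟨h2, h3, h4⟩⟩
  choose D hD hD' using hex
  -- One witness per pair of classes suffices: a set with the same number of points in each class is
  -- found in `A`, and by monomorphy it separates `x` and `y` as the witness separates the
  -- representatives.
  refine ⟨(⋃ q, D q).ncard, fun A hA x y hxy => ?_⟩
  let q := (Quotient.mk (exchange L) x, Quotient.mk (exchange L) y)
  have hqx : exchange L q.1.out x := Quotient.mk_out x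
  have hqy : exchange L q.2.out y := Quotient.mk_out y
  obtain ⟨h1, h2, h3⟩ := hD' q fun h =>
    hxy ((exchange L).trans ((exchange L).symm hqx) ((exchange L).trans h hqy))
  obtain ⟨D', hD'A, hc⟩ := exists_subset_encard_inter_cls (exchange L)
    (encard_inter_cls_le hA (hD q)
      (Set.ncard_le_ncard (Set.subset_iUnion D q) (Set.finite_iUnion hD)) hxy hqx hqy h1 h2)
  have hD'f : D'.Finite := hA.finite.sdiff.subset hD'A
  have hx : x ∉ D' := fun h => (hD'A h).2 (Or.inl rfl)
  have hy : y ∉ D' := fun h => (hD'A h).2 (Or.inr rfl)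
  refine ⟨D', hD'A.trans Set.sdiff_subset, hx, hy, fun h => h3 ?_⟩
  exact (equivalent_insert_of_encard_eq L (hD q) hD'f h1 hx hqx hc).trans
    (h.trans (equivalent_insert_of_encard_eq L (hD q) hD'f h2 hy hqy hc).symm)

/-- Isomorphisms between sufficiently rich sets respect the exchange relation. -/
theorem IsoOn.exchange_iff [Finite (Quotient (exchange L (E := E)))] {A A' : Set E}
    (hfin : A.Finite)
    (hA : ∀ x y, ¬ exchange L x y →
      ∃ D ⊆ A, x ∉ D ∧ y ∉ D ∧ ¬ Equivalent L (insert x D) (insert y D))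
    (hA' : ∀ x y, ¬ exchange L x y →
      ∃ D ⊆ A', x ∉ D ∧ y ∉ D ∧ ¬ Equivalent L (insert x D) (insert y D))
    {f : E → E} (hf : IsoOn L f A A') {x y : E} (hx : x ∈ A) (hy : y ∈ A) :
    exchange L x y ↔ exchange L (f x) (f y) := by
  have himg : ∀ a ∈ A, ∀ D ⊆ A, Equivalent L (insert a D) (insert (f a) (f '' D)) := by
    intro a ha D hD
    rw [equivalent_iff_exists_isoOn, ← Set.image_insert_eq]
    exact ⟨f, hf.mono (Set.insert_subset ha hD)⟩
  have hnot : ∀ a ∈ A, ∀ D ⊆ A, a ∉ D → f a ∉ f '' D := by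
    rintro a ha D hD haD ⟨b, hb, hba⟩
    exact haD (hf.1.injOn (hD hb) ha hba ▸ hb)
  constructor
  · intro h
    by_contra hcon
    obtain ⟨D', hD', h1, h2, h3⟩ := hA' _ _ hcon
    -- A set separating the images is pulled back along `f`; the converse pushes one forward.
    have hD : A ∩ f ⁻¹' D' ⊆ A := Set.inter_subset_left
    have e : f '' (A ∩ f ⁻¹' D') = D' := by
      rw [Set.image_inter_preimage, hf.1.image_eq]
      exact Set.inter_eq_right.2 hD'
    have hx' := himg x hx _ hD
    have hy' := himg y hy _ hD
    rw [e] at hx' hy'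
    exact h3 (hx'.symm.trans ((h _ (hfin.subset hD) (fun h => h1 h.2) fun h => h2 h.2).trans hy'))
  · intro h
    by_contra hcon
    obtain ⟨D, hD, h1, h2, h3⟩ := hA _ _ hcon
    exact h3 ((himg x hx D hD).trans ((h _ ((hfin.subset hD).image f) (hnot x hx D hD h1)
      (hnot y hy D hD h2)).trans (himg y hy D hD).symm))

/-- Isomorphisms between sufficiently rich sets with suitable profiles preserve each infinite
class of the exchange relation. -/
theorem exists_bound_isoOn_preserves_classes [Finite (Quotient (exchange L (E := E)))] :
    ∃ M : ℕ, ∀ A A' : Set E, IsRich (exchange L) M A → IsRich (exchange L) M A' →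
      (∀ x, (A ∩ cls (exchange L) x).ncard = (A' ∩ cls (exchange L) x).ncard) →
      (∀ x y, (cls (exchange L) x).Infinite →
        (A ∩ cls (exchange L) x).ncard = (A ∩ cls (exchange L) y).ncard → exchange L x y) →
      ∀ f : E → E, IsoOn L f A A' → ∀ x ∈ A,
        (cls (exchange L) x).Infinite ∨ (cls (exchange L) (f x)).Infinite →
          exchange L (f x) x := by
  obtain ⟨M, hM⟩ := exists_separating_subset L (E := E)
  refine ⟨M, fun A A' hA hA' hc hd f hf x hx hinf => ?_⟩
  have hiff : ∀ {a b}, a ∈ A → b ∈ A → (exchange L a b ↔ exchange L (f a) (f b)) := fun ha hb =>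
    IsoOn.exchange_iff L hA.finite (hM A hA) (hM A' hA') hf ha hb
  have hb : f '' (A ∩ cls (exchange L) x) = A' ∩ cls (exchange L) (f x) := by
    ext y
    constructor
    · rintro ⟨a, ⟨haA, hax⟩, rfl⟩
      exact ⟨hf.1.mapsTo haA, (hiff haA hx).1 hax⟩
    · rintro ⟨hyA', hyx⟩
      obtain ⟨a, haA, rfl⟩ := hf.1.surjOn hyA'
      exact ⟨a, ⟨haA, (hiff haA hx).2 hyx⟩, rfl⟩
  -- As `f` carries the trace of a class onto the trace of a class, it preserves trace sizes, and
  -- these identify the infinite classes.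
  have hn : (A ∩ cls (exchange L) x).ncard = (A ∩ cls (exchange L) (f x)).ncard := by
    rw [hc (f x), ← hb, Set.InjOn.ncard_image (hf.1.injOn.mono Set.inter_subset_left)]
  rcases hinf with h | h
  · exact (exchange L).symm (hd _ _ h hn)
  · exact hd _ _ h hn.symm

end Exchange

/-! ### Colourings by infinite classes and single points -/

section Colorings

variable {E : Type u} {K : Type*}

/-- The fibres of `c` are the infinite classes of `s` and the singletons of points lying in
finite classes. -/
def IsSplitColoring (s : Setoid E) (c : E → K) : Prop :=
  ∀ x y, c x = c y ↔ x = y ∨ s x y ∧ (cls s x).Infinite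

theorem IsSplitColoring.infinite_of_eq {s : Setoid E} {c : E → K} (hc : IsSplitColoring s c)
    {x y : E} (h : c x = c y) (hx : (cls s x).Infinite) : (cls s y).Infinite := by
  rcases (hc x y).1 h with rfl | ⟨h, -⟩
  · exact hx
  · rwa [← cls_eq h]

theorem IsSplitColoring.eq_of_finite {s : Setoid E} {c : E → K} (hc : IsSplitColoring s c)
    {x y : E} (h : c x = c y) (hx : ¬ (cls s x).Infinite) : x = y :=
  ((hc x y).1 h).elim id fun h => absurd h.2 hx

theorem IsSplitColoring.preimage_eq_cls {s : Setoid E} {c : E → K} (hc : IsSplitColoring s c)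
    {x : E} (hx : (cls s x).Infinite) : c ⁻¹' {c x} = cls s x := by
  ext y
  constructor
  · intro h
    rcases (hc y x).1 h with rfl | h
    · exact mem_cls_self s y
    · exact h.1
  · intro h
    exact (hc y x).2 (Or.inr ⟨h, by rwa [cls_eq h]⟩)

/-- On an infinite fibre the ultrafilter refines the cofinite filter, so generic points avoid any
given point. A finite fibre is a single point in the application and is drawn from only once, so a
principal ultrafilter suffices. -/
theorem exists_ultrafilter_fibre {c : E → K} (hc : Function.Surjective c) (k : K) :
    ∃ U : Ultrafilter E, (∀ᶠ a in (U : Filter E), c a = k) ∧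
      ((c ⁻¹' {k}).Infinite → ∀ b, ∀ᶠ a in (U : Filter E), a ≠ b) := by
  by_cases h : (c ⁻¹' {k}).Infinite
  · have := Filter.cofinite_inf_principal_neBot_iff.2 h
    have hle := Ultrafilter.of_le (Filter.cofinite ⊓ Filter.principal (c ⁻¹' {k}))
    refine ⟨Ultrafilter.of (Filter.cofinite ⊓ Filter.principal (c ⁻¹' {k})), ?_, fun _ b => ?_⟩
    · exact hle (Filter.mem_inf_of_right (Filter.mem_principal_self _))
    · exact hle (Filter.mem_inf_of_left (Set.finite_singleton b).compl_mem_cofinite)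
  · obtain ⟨a, ha⟩ := hc k
    exact ⟨pure a, by simpa using ha, fun h' => absurd h' h⟩

theorem lt_iff_of_pairwise_map [LinearOrder K] {c : E → K} {l : List E}
    (hl : (l.map c).Pairwise (· ≤ ·)) {p q : Fin l.length} (h : c (l.get p) ≠ c (l.get q)) :
    p < q ↔ c (l.get p) < c (l.get q) := by
  rw [List.pairwise_map, List.pairwise_iff_get] at hl
  constructor
  · intro hpq
    exact (hl p q hpq).lt_of_ne h
  · intro hpq
    by_contra! hcon
    rcases hcon.lt_or_eq with h' | h'
    · exact (hl q p h').not_gt hpq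
    · exact h (by rw [h'])

theorem card_filter_eq_count_map [DecidableEq K] (c : E → K) (a : Finset E) (k : K) :
    (a.filter fun x => c x = k).card = (a.val.map c).count k := by
  rw [Multiset.count_map, Finset.card, Finset.filter_val]
  congr 1
  exact Multiset.filter_congr fun x _ => eq_comm

theorem ncard_inter_preimage_singleton [DecidableEq K] (c : E → K) (a : Finset E) (k : K) :
    ((a : Set E) ∩ c ⁻¹' {k}).ncard = (a.val.map c).count k := by
  rw [← card_filter_eq_count_map, ← Set.ncard_coe_finset]
  congr 1
  ext x
  simp

end Colorings

/-! ### Construction of the order -/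

section Chains

variable (L : FirstOrder.Language.{v, w}) {E : Type u} [L.IsRelational] [L.Structure E]

/-- On a suitable finite set, finitely many of the relations are determined by the colours and
the order of the entries within each colour, for some ordering of the set. -/
theorem exists_rank [Finite (Quotient (exchange L (E := E)))] {K : Type*} [LinearOrder K]
    {c : E → K} (hcs : Function.Surjective c) (hc : IsSplitColoring (exchange L) c)
    {A₀ : Set E} (hA₀ : A₀.Finite) {I : Set (Σ n, L.Relations n)} (hI : I.Finite) :
    ∃ rank : E → ℕ, Set.InjOn rank A₀ ∧ ∀ r ∈ I, ∀ x y : Fin r.1 → E, (∀ i, x i ∈ A₀) →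
      (∀ i, y i ∈ A₀) → (∀ i, c (x i) = c (y i)) →
      (∀ i j, c (x i) = c (x j) → (rank (x i) < rank (x j) ↔ rank (y i) < rank (y j))) →
      (FirstOrder.Language.Structure.RelMap r.2 x ↔
        FirstOrder.Language.Structure.RelMap r.2 y) := by
  classical
  obtain ⟨M, hM⟩ := exists_bound_isoOn_preserves_classes L (E := E)
  obtain ⟨A, hA₀A, hA, hAd⟩ := exists_isRich_superset (exchange L) M hA₀
  lift A to Finset E using hA.finite
  choose U hU hU' using exists_ultrafilter_fibre hcs
  -- Sorting makes the colours alone decide the order of list entries of different colours.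
  let w := (A.val.map c).sort (· ≤ ·)
  have hwA : (w : Multiset K) = A.val.map c := Multiset.sort_eq _ _
  -- Finite fibres are singletons, so a colour occurring twice in `A` has an infinite fibre.
  have hw : ∀ k, [k, k].Sublist w → ∀ b, ∀ᶠ a in (U k : Filter E), a ≠ b := by
    intro k hk
    refine hU' k fun hfin => ?_
    have h1 := hk.count_le k
    have h2 : w.count k = (A.filter fun x => c x = k).card := by
      rw [card_filter_eq_count_map, ← hwA, Multiset.coe_count]
    have h3 : (A.filter fun x => c x = k).card ≤ 1 := by
      refine Finset.card_le_one.2 fun a ha b hb => ?_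
      have ha' : c a = k := (Finset.mem_filter.1 ha).2
      have hb' : c b = k := (Finset.mem_filter.1 hb).2
      refine hc.eq_of_finite (ha'.trans hb'.symm) fun hinf => ?_
      rw [← hc.preimage_eq_cls hinf, ha'] at hinf
      exact hinf hfin
    rw [h2] at h1
    simp at h1
    omega
  obtain ⟨l, hlw, hnd, hl⟩ := exists_indiscernible_list hU w hw
    ((fun r : Σ n, L.Relations n =>
      (⟨r.1, fun z => FirstOrder.Language.Structure.RelMap r.2 z⟩ :
        Σ n : ℕ, (Fin n → E) → Prop)) '' I) (hI.image _)
  have hlA : l.toFinset.val.map c = A.val.map c := by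
    rw [← hwA, ← hlw, List.toFinset_val, hnd.dedup, Multiset.map_coe]
  have hfinA' : ∀ x, (cls (exchange L) x).Finite →
      cls (exchange L) x ⊆ (l.toFinset : Set E) := by
    intro x hx y hy
    have h1 : c y ∈ l.toFinset.val.map c := by
      rw [hlA]
      exact Multiset.mem_map_of_mem c (hA.subset x hx hy)
    obtain ⟨y', hy', hyy'⟩ := Multiset.mem_map.1 h1
    have h2 : y = y' := hc.eq_of_finite hyy'.symm (by
      rw [cls_eq hy]
      exact fun h => h hx)
    rw [h2]
    exact hy'
  have hprof : ∀ x, ((A : Set E) ∩ cls (exchange L) x).ncard =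
      ((l.toFinset : Set E) ∩ cls (exchange L) x).ncard := by
    intro x
    by_cases hx : (cls (exchange L) x).Finite
    · rw [Set.inter_eq_right.2 (hA.subset x hx), Set.inter_eq_right.2 (hfinA' x hx)]
    · rw [← hc.preimage_eq_cls hx, ncard_inter_preimage_singleton,
        ncard_inter_preimage_singleton, hlA]
  have hA' : IsRich (exchange L) M (l.toFinset : Set E) :=
    ⟨Finset.finite_toSet _, hfinA', fun x hx => hprof x ▸ hA.lt_ncard x hx⟩
  obtain ⟨f, hf⟩ : ∃ f : E → E, IsoOn L f (A : Set E) (l.toFinset : Set E) := by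
    rw [← equivalent_iff_exists_isoOn]
    refine (exchange_classes_isMonomorphicDecomposition L).2 _ _ hA.finite hA'.finite ?_
    rintro _ ⟨x, rfl⟩
    have h := hprof x
    rw [← Nat.cast_inj (R := ℕ∞), (hA.finite.subset Set.inter_subset_left).cast_ncard_eq,
      (hA'.finite.subset Set.inter_subset_left).cast_ncard_eq] at h
    exact h
  have hcf : ∀ x ∈ A, (cls (exchange L) x).Infinite ∨ (cls (exchange L) (f x)).Infinite →
      c (f x) = c x := by
    intro x hx hinf
    have h := hM _ _ hA hA' hprof hAd f hf x hx hinf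
    refine (hc _ _).2 (Or.inr ⟨h, ?_⟩)
    rcases hinf with hinf | hinf
    · rwa [cls_eq h]
    · exact hinf
  -- The colour itself may change under `f` at points of finite classes; only equality of colours is
  -- transported, in both directions.
  have hcc : ∀ x ∈ A, ∀ y ∈ A, c x = c y → c (f x) = c (f y) := by
    intro x hx y hy hxy
    by_cases hinf : (cls (exchange L) x).Infinite
    · rw [hcf x hx (Or.inl hinf), hcf y hy (Or.inl (hc.infinite_of_eq hxy hinf)), hxy]
    · rw [hc.eq_of_finite hxy hinf]
  have hcc' : ∀ x ∈ A, ∀ y ∈ A, c (f x) = c (f y) → c x = c y := by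
    intro x hx y hy hxy
    by_cases hinf : (cls (exchange L) (f x)).Infinite
    · rw [← hcf x hx (Or.inr hinf), ← hcf y hy (Or.inr (hc.infinite_of_eq hxy hinf)), hxy]
    · rw [hf.1.injOn hx hy (hc.eq_of_finite hxy hinf)]
  have hfl : ∀ x ∈ A, f x ∈ l := fun x hx => List.mem_toFinset.1 (hf.1.mapsTo hx)
  have hsort : (l.map c).Pairwise (· ≤ ·) := by
    rw [hlw]
    exact Multiset.pairwise_sort _ _
  refine ⟨fun a => l.idxOf (f a), ?_, ?_⟩
  · intro x hx y hy hxy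
    exact hf.1.injOn (hA₀A hx) (hA₀A hy) ((List.idxOf_inj (hfl x (hA₀A hx))).1 hxy)
  · intro r hr x y hx hy hxy hord
    replace hx := fun i => hA₀A (hx i)
    replace hy := fun i => hA₀A (hy i)
    let s : Fin r.1 → Fin l.length := fun i =>
      ⟨l.idxOf (f (x i)), List.idxOf_lt_length_of_mem (hfl _ (hx i))⟩
    let t : Fin r.1 → Fin l.length := fun i =>
      ⟨l.idxOf (f (y i)), List.idxOf_lt_length_of_mem (hfl _ (hy i))⟩
    have hs : ∀ i, l.get (s i) = f (x i) := fun i => List.getElem_idxOf _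
    have ht : ∀ i, l.get (t i) = f (y i) := fun i => List.getElem_idxOf _
    have hst : ∀ i, c (l.get (s i)) = c (l.get (t i)) := fun i => by
      rw [hs, ht]
      exact hcc _ (hx i) _ (hy i) (hxy i)
    have h := hl _ ⟨r, hr, rfl⟩ s t hst fun i j => by
      -- Within a colour the order agrees by hypothesis; between colours it is forced by the sorting
      -- of the list.
      by_cases hij : c (x i) = c (x j)
      · exact hord i j hij
      · have h1 : c (l.get (s i)) ≠ c (l.get (s j)) := by
          rw [hs, hs]
          exact fun e => hij (hcc' _ (hx i) _ (hx j) e)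
        have h2 : c (l.get (t i)) ≠ c (l.get (t j)) := by
          rwa [← hst, ← hst]
        rw [lt_iff_of_pairwise_map hsort h1, lt_iff_of_pairwise_map hsort h2, hst, hst]
    have e1 : l.get ∘ s = f ∘ x := funext hs
    have e2 : l.get ∘ t = f ∘ y := funext ht
    rw [e1, e2] at h
    exact (hf.2 _ r.2 x hx).symm.trans (h.trans (hf.2 _ r.2 y hy))

/-- There is a linear order on `E` in which the fibres of `c` are intervals and such that every
relation is determined by the colours and the order of the entries. -/
theorem exists_linearOrder_relMap_iff [Finite (Quotient (exchange L (E := E)))] {K : Type*}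
    [LinearOrder K] {c : E → K} (hcs : Function.Surjective c)
    (hc : IsSplitColoring (exchange L) c) :
    ∃ _ : LinearOrder E, (∀ k, (c ⁻¹' {k}).OrdConnected) ∧
      ∀ (n : ℕ) (r : L.Relations n) (x y : Fin n → E), (∀ i, c (x i) = c (y i)) →
        (∀ i j, x i < x j ↔ y i < y j) →
        (FirstOrder.Language.Structure.RelMap r x ↔
          FirstOrder.Language.Structure.RelMap r y) := by
  classical
  let J := Finset E × Finset (Σ n, L.Relations n)
  choose rank hinj hrank using fun j : J =>
    exists_rank L hcs hc j.1.finite_toSet j.2.finite_toSet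
  -- As `V` refines `atTop`, almost every index contains any given finite set of points and
  -- relations.
  let V : Ultrafilter J := Ultrafilter.of Filter.atTop
  have hV : ∀ j₀, ∀ᶠ j in (V : Filter J), j₀ ≤ j := fun j₀ =>
    Ultrafilter.of_le _ (Filter.eventually_ge_atTop j₀)
  let g : E → (V : Filter J).Germ ℕ := fun a => ((fun j => rank j a : _ → ℕ) :)
  have hlt : ∀ a b, g a < g b ↔ ∀ᶠ j in (V : Filter J), rank j a < rank j b := fun a b =>
    Filter.Germ.coe_lt
  have hg : Function.Injective g := by
    intro a b hab
    have h : ∀ᶠ j in (V : Filter J), rank j a = rank j b := Filter.Germ.coe_eq.1 hab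
    obtain ⟨j, hj, hj'⟩ := (h.and (hV ({a, b}, ∅))).exists
    exact hinj j (hj'.1 (by simp)) (hj'.1 (by simp)) hj
  -- Colour comes first, which makes the fibres intervals; within a colour the germs of the rankings
  -- decide.
  let e : E → K ×ₗ (V : Filter J).Germ ℕ := fun a => toLex (c a, g a)
  have he : Function.Injective e := fun a b hab => hg (congrArg Prod.snd (toLex.injective hab))
  let _ : LinearOrder E := LinearOrder.lift' e he
  have hEle : ∀ a b : E, a ≤ b → c a ≤ c b := fun a b hab => by
    rcases Prod.Lex.toLex_le_toLex.1 (show e a ≤ e b from hab) with h | h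
    · exact h.le
    · exact h.1.le
  have hElt : ∀ a b : E, c a = c b → (a < b ↔ g a < g b) := fun a b hab => by
    change toLex (c a, g a) < toLex (c b, g b) ↔ _
    rw [Prod.Lex.toLex_lt_toLex]
    simp [hab]
  refine ⟨inferInstance, ?_, ?_⟩
  · intro k
    refine ⟨fun a ha b hb z hz => ?_⟩
    have ha' : c a = k := ha
    have hb' : c b = k := hb
    exact le_antisymm (hb' ▸ hEle z b hz.2) (ha' ▸ hEle a z hz.1)
  · intro n r x y hxy hord
    -- Only finitely many comparisons occur and `V` decides each, so a single index can reproduce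
    -- the agreement of both tuples.
    have h : ∀ᶠ j in (V : Filter J), ∀ i i', c (x i) = c (x i') →
        (rank j (x i) < rank j (x i') ↔ rank j (y i) < rank j (y i')) := by
      rw [Filter.eventually_all]
      intro i
      rw [Filter.eventually_all]
      intro i'
      by_cases hii' : c (x i) = c (x i')
      · have h1 := hord i i'
        rw [hElt _ _ hii', hElt _ _ (by rw [← hxy, ← hxy, hii'])] at h1
        by_cases h2 : g (x i) < g (x i')
        · filter_upwards [(hlt _ _).1 h2, (hlt _ _).1 (h1.1 h2)] with j ha hb _
          exact iff_of_true ha hb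
        · have h3 : ¬ g (y i) < g (y i') := fun h => h2 (h1.2 h)
          rw [hlt] at h2 h3
          filter_upwards [Ultrafilter.eventually_not.2 h2, Ultrafilter.eventually_not.2 h3]
            with j ha hb _
          exact iff_of_false ha hb
      · exact Filter.Eventually.of_forall fun _ h => absurd h hii'
    obtain ⟨j, hj, hj'⟩ := (h.and
      (hV (Finset.univ.image x ∪ Finset.univ.image y, {⟨n, r⟩}))).exists
    refine hrank j ⟨n, r⟩ (hj'.2 (by simp)) x y (fun i => hj'.1 ?_) (fun i => hj'.1 ?_) hxy hj
    · exact Finset.mem_union_left _ (Finset.mem_image_of_mem x (Finset.mem_univ i))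
    · exact Finset.mem_union_right _ (Finset.mem_image_of_mem y (Finset.mem_univ i))

/-- The equivalence relation splitting the finite classes of `s` into singletons. -/
def splitFinite (s : Setoid E) : Setoid E where
  r x y := x = y ∨ s x y ∧ (cls s x).Infinite
  iseqv :=
    { refl := fun _ => Or.inl rfl
      symm := by
        rintro x y (rfl | ⟨h, hx⟩)
        · exact Or.inl rfl
        · exact Or.inr ⟨s.symm h, cls_eq h ▸ hx⟩
      trans := by
        rintro x y z (rfl | ⟨h, hx⟩) (rfl | ⟨h', hy⟩)
        · exact Or.inl rfl
        · exact Or.inr ⟨h', hy⟩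
        · exact Or.inr ⟨h, hx⟩
        · exact Or.inr ⟨s.trans h h', hx⟩ }

theorem cls_splitFinite_of_infinite {s : Setoid E} {x : E} (hx : (cls s x).Infinite) :
    cls (splitFinite s) x = cls s x :=
  Set.ext fun _ => ⟨fun h => h.elim (fun e => e ▸ mem_cls_self s x) fun h => h.1,
    fun h => Or.inr ⟨h, cls_eq h ▸ hx⟩⟩

theorem cls_splitFinite_of_finite {s : Setoid E} {x : E} (hx : (cls s x).Finite) :
    cls (splitFinite s) x = {x} :=
  Set.ext fun _ => ⟨fun h => h.elim id fun h => absurd (cls_eq h.1 ▸ hx) h.2, Or.inl⟩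

/-- Finitely many finite classes have finitely many points in all, so splitting adds finitely many
blocks. -/
theorem finite_classes_splitFinite {s : Setoid E} (hs : s.classes.Finite) :
    (splitFinite s).classes.Finite := by
  have hF : (⋃ B ∈ {B ∈ s.classes | B.Finite}, B).Finite :=
    (hs.subset fun B hB => hB.1).biUnion fun B hB => hB.2
  refine (hs.union (hF.image fun x => ({x} : Set E))).subset ?_
  rintro _ ⟨x, rfl⟩
  change cls (splitFinite s) x ∈ _
  by_cases hx : (cls s x).Finite
  · rw [cls_splitFinite_of_finite hx]
    exact Or.inr ⟨x, Set.mem_biUnion (show cls s x ∈ _ from ⟨⟨x, rfl⟩, hx⟩)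
      (mem_cls_self s x), rfl⟩
  · rw [cls_splitFinite_of_infinite hx]
    exact Or.inl ⟨x, rfl⟩

theorem numInfiniteBlocks_splitFinite (s : Setoid E) :
    numInfiniteBlocks (splitFinite s).classes = numInfiniteBlocks s.classes := by
  unfold numInfiniteBlocks
  congr 1
  ext B
  constructor
  · rintro ⟨⟨x, rfl⟩, hB⟩
    change (cls (splitFinite s) x).Infinite at hB
    change cls (splitFinite s) x ∈ _
    by_cases hx : (cls s x).Finite
    · rw [cls_splitFinite_of_finite hx] at hB
      exact absurd (Set.finite_singleton x) hB
    · rw [cls_splitFinite_of_infinite hx]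
      exact ⟨⟨x, rfl⟩, hx⟩
  · rintro ⟨⟨x, rfl⟩, hB⟩
    change cls s x ∈ _
    rw [← cls_splitFinite_of_infinite hB]
    refine ⟨⟨x, rfl⟩, ?_⟩
    rw [cls_splitFinite_of_infinite hB]
    exact hB

/-- Each block of a decomposition lies in one exchange class, and every class contains a block, so
there are at most as many classes as blocks. -/
theorem finite_classes_exchange (h : HasFiniteMonomorphicDecomposition L E) :
    (exchange L (E := E)).classes.Finite := by
  obtain ⟨Q, hQf, hQ⟩ := h
  have hr := (exchange_classes_isMinimalDecomposition L).2 Q hQ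
  choose! F hF hQF using hr
  refine (hQf.image F).subset ?_
  intro C hC
  obtain ⟨x, hx⟩ := Setoid.nonempty_of_mem_partition (Setoid.isPartition_classes _) hC
  obtain ⟨B, hB, hxB⟩ := (hQ.1.2 x).exists
  refine ⟨B, hB, ?_⟩
  by_contra hne
  exact Set.disjoint_left.1 ((Setoid.isPartition_classes (exchange L (E := E))).pairwiseDisjoint
    (hF B hB) hC hne) (hQF B hB hxB) hx

variable (E) in
theorem minimalDecomposition_eq : minimalDecomposition L E = (exchange L (E := E)).classes :=
  (existsUnique_isMinimalDecomposition L (E := E)).unique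
    (existsUnique_isMinimalDecomposition L (E := E)).choose_spec.1
    (exchange_classes_isMinimalDecomposition L)

theorem exists_isChainablePartition (h : HasFiniteMonomorphicDecomposition L E) :
    ∃ _ : LinearOrder E,
      IsChainablePartition L (splitFinite (exchange L (E := E))).classes := by
  classical
  have hfin := finite_classes_exchange L h
  have : Finite (exchange L (E := E)).classes := hfin
  have : Finite (Quotient (exchange L (E := E))) :=
    Finite.of_equiv _ (Setoid.quotientEquivClasses _).symm
  let t := splitFinite (exchange L (E := E))
  let c : E → Quotient t := Quotient.mk t
  have hc : IsSplitColoring (exchange L) c := fun x y => Quotient.eq (r := t)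
  -- Any order on the set of blocks will do.
  let _ : LinearOrder (Quotient t) := linearOrderOfSTO WellOrderingRel
  obtain ⟨o, hI, hR⟩ := exists_linearOrder_relMap_iff L Quotient.mk_surjective hc
  refine ⟨o, Setoid.isPartition_classes _, finite_classes_splitFinite hfin, ?_, ?_⟩
  · rintro _ ⟨x, rfl⟩
    have e : {y | t y x} = c ⁻¹' {c x} := Set.ext fun y => (Quotient.eq (r := t)).symm
    rw [e]
    exact hI _
  · intro A A' f hf
    refine isLocalIso_of_relMap_iff L _ fun n r x => hR n r _ _ (fun i => ?_) fun i j => ?_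
    · exact Quotient.sound (hf _ (t.mem_classes (x i)) (x i) (t.refl _))
    · exact f.lt_iff_lt

end Chains

end Monomorphic

theorem mainTheorem2 {L : FirstOrder.Language.{v, w}} [L.IsRelational]
    {E : Type u} [L.Structure E] :
    (Monomorphic.HasFiniteMonomorphicDecomposition L E ↔
      ∃ (_ : LinearOrder E) (P : Set (Set E)), Monomorphic.IsChainablePartition L P) ∧
    (Monomorphic.HasFiniteMonomorphicDecomposition L E →
      ∃ (_ : LinearOrder E) (P : Set (Set E)), Monomorphic.IsChainablePartition L P ∧
        Monomorphic.numInfiniteBlocks P = Monomorphic.monomorphicDimension L E) := by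
  refine ⟨⟨fun h => ?_, ?_⟩, fun h => ?_⟩
  · obtain ⟨o, ho⟩ := Monomorphic.exists_isChainablePartition L h
    exact ⟨o, _, ho⟩
  · rintro ⟨o, P, hP⟩
    exact ⟨P, hP.2.1, hP.isMonomorphicDecomposition⟩
  · obtain ⟨o, ho⟩ := Monomorphic.exists_isChainablePartition L h
    refine ⟨o, _, ho, ?_⟩
    rw [Monomorphic.numInfiniteBlocks_splitFinite, Monomorphic.monomorphicDimension,
      Monomorphic.minimalDecomposition_eq]
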